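/- Call a set $S\subset\mathbb{R}^3$ a real algebraic surface if it is the set of common real zeros of some family of polynomials in $\mathbb{R}[x,y,z]$ and has dimension $2$ (that is, the ring of polynomials modulo those vanishing on $S$ has Krull dimension $2$); it need not be irreducible. It is cylindrical if it is a union of lines that are all parallel to one given direction. It is a surface of revolution if there is a line $\ell$ such that $S$ is invariant under every rotation about $\ell$. A symmetry plane of $S$ is a plane such that $S$ is invariant under the orthogonal reflection in it. Let $S\subset\mathbb{R}^3$ be a non-cylindrical real algebraic surface. (1) If $S$ is not a surface of revolution, then $S$ has only finitely many symmetry planes (possibly none), and there is a point of $\mathbb{R}^3$ that lies on all of them. (2) $S$ is a surface of revolution if and only if $S$ has infinitely many symmetry planes. -/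

import Mathlib

namespace SymmetryPlanes

/-- Euclidean three-space. -/
abbrev E3 : Type := EuclideanSpace ℝ (Fin 3)

/-- The ideal of all real polynomials in three variables that vanish on `S`. -/
noncomputable def idealOf (S : Set E3) : Ideal (MvPolynomial (Fin 3) ℝ) :=
  MvPolynomial.vanishingIdeal ℝ (WithLp.ofLp '' S)

/-- `S` is a real algebraic surface: the set of common real zeros of a family of real polynomials,
of dimension two, the dimension of a real algebraic set being the Krull dimension of its
coordinate ring. Neither irreducibility nor smoothness is required. -/
def IsAlgebraicSurface (S : Set E3) : Prop :=
  (∃ F : Set (MvPolynomial (Fin 3) ℝ),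
      S = {p : E3 | ∀ f ∈ F, MvPolynomial.eval (fun i => p i) f = 0}) ∧
    ringKrullDim (MvPolynomial (Fin 3) ℝ ⧸ idealOf S) = 2

/-- `S` is cylindrical: it is a union of lines that are all parallel to one direction `a`. -/
def IsCylindrical (S : Set E3) : Prop :=
  ∃ a : E3, a ≠ 0 ∧ ∀ p ∈ S, ∀ t : ℝ, p + t • a ∈ S

/-- The cross product of Euclidean three-space. -/
noncomputable def cross (v w : E3) : E3 :=
  WithLp.toLp 2 (crossProduct (WithLp.ofLp v) (WithLp.ofLp w))

/-- The rotation by the angle `θ` about the line through `q` with unit direction vector `u`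
(Rodrigues' formula). -/
noncomputable def axisRotation (q u : E3) (θ : ℝ) (p : E3) : E3 :=
  q + (Real.cos θ • (p - q) + Real.sin θ • cross u (p - q)
    + ((1 - Real.cos θ) * inner ℝ u (p - q)) • u)

/-- `S` is a surface of revolution: there is a line such that `S` is invariant under every
rotation about it. -/
def IsSurfaceOfRevolution (S : Set E3) : Prop :=
  ∃ q u : E3, ‖u‖ = 1 ∧ ∀ θ : ℝ, axisRotation q u θ '' S = S

/-- `π` is a symmetry plane of `S`: a plane such that `S` is invariant under the orthogonal
reflection in it. -/
def IsSymmetryPlane (S : Set E3) (π : AffineSubspace ℝ E3) : Prop :=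
  Module.finrank ℝ π.direction = 2 ∧
    ∃ _ : Nonempty π, EuclideanGeometry.reflection π '' S = S

end SymmetryPlanes

/-! An isometry `g` mapping `S` into itself is, about a suitable point `q`, its linear part `R`
followed by a translation by a vector `b` fixed by `R`. If `b ≠ 0`, the orbit of `x ∈ S` is `q + R^n
(x - q) + n b`. A defining polynomial on it is a polynomial in `n` whose coefficients recur, because
orbits of `R` do; so all coefficients vanish, and the line through `x` along `b` lies in `S`. Hence
if `S` is not cylindrical, every such `g` has a fixed point (`exists_fixedPoint`).

Let the fixed set of `g` have least dimension. If a fixed point `p` of `g` missed a symmetry plane,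
composing `g` with that reflection would give a smaller fixed set, again nonempty. So `p` lies on
all symmetry planes (`exists_mem_of_isSymmetryPlane`).

If there are infinitely many planes, their normals accumulate, and products of two reflections are
arbitrarily small rotations; closedness of `S` yields all rotations about a limit axis. Conversely,
a reflection in a plane through an axis of revolution moves each point within its circle about the
axis. -/

namespace SymmetryPlanes

open Filter Topology Module

local notation "⟪" x ", " y "⟫" => inner ℝ x y

/-! ### Rotations, reflections and the cross product -/

/-- The rotation by the angle `t` in the plane of the orthonormal pair `a`, `b`. -/
noncomputable def planeRot (a b : E3) (t : ℝ) (x : E3) : E3 :=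
  x + (Real.cos t - 1) • (⟪a, x⟫ • a + ⟪b, x⟫ • b) + Real.sin t • (⟪a, x⟫ • b - ⟪b, x⟫ • a)

/-- The reflection in the plane through the origin with unit normal `n`. -/
noncomputable def planeRefl (n x : E3) : E3 := x - (2 * ⟪n, x⟫) • n

theorem planeRot_add {a b : E3} (ha : ‖a‖ = 1) (hb : ‖b‖ = 1) (hab : ⟪a, b⟫ = 0) (s t : ℝ)
    (x : E3) : planeRot a b (s + t) x = planeRot a b s (planeRot a b t x) := by
  have haa : ⟪a, a⟫ = 1 := by rw [real_inner_self_eq_norm_sq, ha]; norm_num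
  have hbb : ⟪b, b⟫ = 1 := by rw [real_inner_self_eq_norm_sq, hb]; norm_num
  have hba : ⟪b, a⟫ = 0 := by rw [real_inner_comm]; exact hab
  simp only [planeRot, inner_add_right, inner_sub_right, inner_smul_right, haa, hbb, hab, hba,
    Real.cos_add, Real.sin_add]
  module

theorem planeRot_add_nat_mul_two_pi (a b : E3) (t : ℝ) (n : ℕ) :
    planeRot a b (t + n * (2 * Real.pi)) = planeRot a b t := by
  funext x
  simp only [planeRot, Real.cos_add_nat_mul_two_pi, Real.sin_add_nat_mul_two_pi]

theorem planeRot_zero (a b x : E3) : planeRot a b 0 x = x := by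
  simp [planeRot]

/-- The product of two reflections is a rotation by twice the angle of the planes. -/
theorem planeRefl_planeRefl {a b : E3} (ha : ‖a‖ = 1) (hab : ⟪a, b⟫ = 0) (t : ℝ) (x : E3) :
    planeRefl (Real.cos t • a + Real.sin t • b) (planeRefl a x) = planeRot a b (2 * t) x := by
  have haa : ⟪a, a⟫ = 1 := by rw [real_inner_self_eq_norm_sq, ha]; norm_num
  have hba : ⟪b, a⟫ = 0 := by rw [real_inner_comm]; exact hab
  have h := Real.sin_sq_add_cos_sq t
  simp only [planeRefl, planeRot, inner_sub_right, inner_add_left, inner_smul_left,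
    inner_smul_right, haa, hba, Real.cos_two_mul, Real.sin_two_mul, RCLike.conj_to_real]
  match_scalars
  · ring
  · ring
  · linear_combination (-2 * ⟪b, x⟫) * h

theorem inner_eq (x y : E3) : ⟪x, y⟫ = x 0 * y 0 + x 1 * y 1 + x 2 * y 2 := by
  simp only [PiLp.inner_apply, Fin.sum_univ_three, RCLike.inner_apply, RCLike.conj_to_real]
  ring

theorem cross_cross_right (a b w : E3) : cross (cross a b) w = ⟪a, w⟫ • b - ⟪b, w⟫ • a := by
  rw [inner_eq, inner_eq]
  ext i
  fin_cases i <;> simp [cross, crossProduct] <;> ring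

theorem cross_cross_left (a b w : E3) : cross a (cross b w) = ⟪a, w⟫ • b - ⟪a, b⟫ • w := by
  rw [inner_eq, inner_eq]
  ext i
  fin_cases i <;> simp [cross, crossProduct] <;> ring

theorem inner_cross_self_left (u x : E3) : ⟪u, cross u x⟫ = 0 := by
  rw [inner_eq]; simp [cross, crossProduct]; ring

theorem inner_cross_self_right (u x : E3) : ⟪x, cross u x⟫ = 0 := by
  rw [inner_eq]; simp [cross, crossProduct]; ring

theorem norm_cross_sq (a b : E3) : ‖cross a b‖ ^ 2 = ‖a‖ ^ 2 * ‖b‖ ^ 2 - ⟪a, b⟫ ^ 2 := by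
  simp only [← real_inner_self_eq_norm_sq]
  simp only [inner_eq]
  simp [cross, crossProduct]; ring

theorem norm_cross_of_orthonormal {a b : E3} (ha : ‖a‖ = 1) (hb : ‖b‖ = 1) (hab : ⟪a, b⟫ = 0) :
    ‖cross a b‖ = 1 := by
  have h := norm_cross_sq a b
  rw [ha, hb, hab] at h
  have := norm_nonneg (cross a b)
  nlinarith

/-- Rodrigues' formula describes the rotation in the plane of `a`, `b` when the axis is `a × b`. -/
theorem axisRotation_cross {a b : E3} (ha : ‖a‖ = 1) (hb : ‖b‖ = 1) (hab : ⟪a, b⟫ = 0)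
    (q : E3) (t : ℝ) (p : E3) :
    axisRotation q (cross a b) t p = q + planeRot a b t (p - q) := by
  have haa : ⟪a, a⟫ = 1 := by rw [real_inner_self_eq_norm_sq, ha]; norm_num
  have hbb : ⟪b, b⟫ = 1 := by rw [real_inner_self_eq_norm_sq, hb]; norm_num
  have hba : ⟪b, a⟫ = 0 := by rw [real_inner_comm]; exact hab
  have huu : ⟪cross a b, cross a b⟫ = 1 := by
    rw [real_inner_self_eq_norm_sq, norm_cross_of_orthonormal ha hb hab]; norm_num
  -- Evaluating `u × (u × w)` in two ways, with `u = a × b`, splits `w` into its components along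
  -- `a`, `b` and `u`.
  have h := cross_cross_left (cross a b) (cross a b) (p - q)
  rw [cross_cross_right, cross_cross_right, huu] at h
  simp only [inner_sub_right, inner_smul_right, haa, hbb, hab, hba] at h
  unfold axisRotation planeRot
  rw [cross_cross_right, mul_smul]
  simp only [inner_sub_right] at h ⊢
  have h2 : (⟪cross a b, p⟫ - ⟪cross a b, q⟫) • cross a b = (p - q) -
      ((⟪a, p⟫ - ⟪a, q⟫) • a + (⟪b, p⟫ - ⟪b, q⟫) • b) := by
    linear_combination (norm := module) (-1 : ℝ) • h
  rw [h2]
  module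

/-! ### Planes and their unit normals -/

/-- A plane has a unit normal vector. -/
theorem exists_normal {π : AffineSubspace ℝ E3} (hπ : finrank ℝ π.direction = 2) {p : E3}
    (hp : p ∈ π) :
    ∃ n : E3, ‖n‖ = 1 ∧ π = AffineSubspace.mk' p (ℝ ∙ n)ᗮ := by
  have h1 := π.direction.finrank_add_finrank_orthogonal
  have h3 : finrank ℝ E3 = 3 := by simp
  have hpos : 0 < finrank ℝ π.directionᗮ := by omega
  obtain ⟨⟨v, hv⟩, hv0⟩ := (finrank_pos_iff_exists_ne_zero (R := ℝ)).1 hpos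
  have hv0' : v ≠ 0 := fun h => hv0 (by simpa using h)
  have hn0 : ‖v‖⁻¹ ≠ 0 := inv_ne_zero (norm_ne_zero_iff.2 hv0')
  refine ⟨‖v‖⁻¹ • v, norm_smul_inv_norm hv0', ?_⟩
  have hspan : (ℝ ∙ (‖v‖⁻¹ • v)) = ℝ ∙ v :=
    Submodule.span_singleton_smul_eq (IsUnit.mk0 _ hn0) v
  have hle : π.direction ≤ (ℝ ∙ v)ᗮ := by
    intro w hw
    rw [Submodule.mem_orthogonal_singleton_iff_inner_left]
    exact hv w hw
  have h4 := (ℝ ∙ v).finrank_add_finrank_orthogonal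
  rw [finrank_span_singleton hv0'] at h4
  have hdir : π.direction = (ℝ ∙ v)ᗮ := Submodule.eq_of_le_of_finrank_eq hle (by omega)
  rw [hspan, ← hdir, AffineSubspace.mk'_eq hp]

theorem mem_mk'_orthogonal {n p x : E3} :
    x ∈ AffineSubspace.mk' p (ℝ ∙ n)ᗮ ↔ ⟪n, x - p⟫ = 0 := by
  rw [AffineSubspace.mem_mk', Submodule.mem_orthogonal_singleton_iff_inner_right, vsub_eq_sub]

theorem reflection_mk' {n : E3} (hn : ‖n‖ = 1) (p : E3)
    [Nonempty (AffineSubspace.mk' p (ℝ ∙ n)ᗮ)] (x : E3) :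
    EuclideanGeometry.reflection (AffineSubspace.mk' p (ℝ ∙ n)ᗮ) x =
      p + planeRefl n (x - p) := by
  have hnn : ⟪n, n⟫ = 1 := by rw [real_inner_self_eq_norm_sq, hn]; norm_num
  have h1 : x - ⟪n, x - p⟫ • n ∈ AffineSubspace.mk' p (ℝ ∙ n)ᗮ := by
    rw [mem_mk'_orthogonal]
    simp only [inner_sub_right, inner_smul_right, hnn]
    ring
  have h2 : ⟪n, x - p⟫ • n ∈ (AffineSubspace.mk' p (ℝ ∙ n)ᗮ).directionᗮ := by
    rw [AffineSubspace.direction_mk', Submodule.orthogonal_orthogonal]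
    exact Submodule.smul_mem _ _ (Submodule.mem_span_singleton_self n)
  have h := EuclideanGeometry.reflection_orthogonal_vadd h1 h2
  rw [vadd_eq_add, vadd_eq_add, add_sub_cancel] at h
  rw [h, planeRefl]
  module

/-- Symmetry planes through `p` in terms of their unit normals. -/
theorem isSymmetryPlane_mk'_iff {S : Set E3} {n : E3} (hn : ‖n‖ = 1) (p : E3) :
    IsSymmetryPlane S (AffineSubspace.mk' p (ℝ ∙ n)ᗮ) ↔
      ∀ x, p + x ∈ S → p + planeRefl n x ∈ S := by
  have hne : Nonempty (AffineSubspace.mk' p (ℝ ∙ n)ᗮ) := ⟨⟨p, AffineSubspace.self_mem_mk' _ _⟩⟩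
  have hn0 : n ≠ 0 := by rintro rfl; simp at hn
  constructor
  · rintro ⟨-, hne', h⟩ x hx
    have := h ▸ Set.mem_image_of_mem _ hx
    rwa [reflection_mk' hn, add_sub_cancel_left] at this
  · intro h
    have key : ∀ x ∈ S, EuclideanGeometry.reflection (AffineSubspace.mk' p (ℝ ∙ n)ᗮ) x ∈ S := by
      intro x hx
      rw [reflection_mk' hn]
      exact h _ (by simpa using hx)
    refine ⟨?_, hne, Set.Subset.antisymm (Set.image_subset_iff.2 key) fun x hx =>
      ⟨_, key x hx, EuclideanGeometry.reflection_reflection _ x⟩⟩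
    have h4 := (ℝ ∙ n).finrank_add_finrank_orthogonal
    have h3 : finrank ℝ E3 = 3 := by simp
    rw [finrank_span_singleton hn0] at h4
    rw [AffineSubspace.direction_mk']
    omega

/-! ### Recurrence and fixed points of isometries -/

/-- A polynomial expression in `n` with recurrent coefficients that vanishes for all `n`
has vanishing coefficients. -/
theorem eq_zero_of_sum_mul_pow_eq_zero {δ : ℕ → ℕ} (hδ : Tendsto δ atTop atTop)
    {c : ℕ → ℕ → ℝ}
    (hrec : ∀ k m, Tendsto (fun j => c k (m + δ j)) atTop (𝓝 (c k m))) (K : ℕ)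
    (h : ∀ n : ℕ, ∑ k ∈ Finset.range K, c k n * (n : ℝ) ^ k = 0) :
    ∀ k < K, ∀ m, c k m = 0 := by
  induction K with
  | zero => intro k hk; omega
  | succ K ih =>
    have htop : ∀ m, c K m = 0 := by
      intro m
      -- Divide by the `K`-th power along `n = m + δ j`: the lower terms tend to zero, the leading
      -- one to `c K m`.
      have hN : Tendsto (fun j => ((m + δ j : ℕ) : ℝ)) atTop atTop :=
        tendsto_natCast_atTop_atTop.comp (tendsto_atTop_mono (fun j => Nat.le_add_left _ m) hδ)
      have hlow : Tendsto (fun j => ∑ k ∈ Finset.range K,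
          c k (m + δ j) * (((m + δ j : ℕ) : ℝ) ^ (K - k))⁻¹) atTop (𝓝 0) := by
        rw [← Finset.sum_const_zero (s := Finset.range K)]
        refine tendsto_finsetSum _ fun k hk => ?_
        have hk' : K - k ≠ 0 := by have := Finset.mem_range.1 hk; omega
        have h0 : Tendsto (fun j => (((m + δ j : ℕ) : ℝ) ^ (K - k))⁻¹) atTop (𝓝 0) :=
          tendsto_inv_atTop_zero.comp ((tendsto_pow_atTop hk').comp hN)
        simpa using (hrec k m).mul h0
      have hsum := (hrec K m).add hlow
      rw [add_zero] at hsum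
      refine tendsto_nhds_unique hsum (tendsto_const_nhds.congr' ?_)
      filter_upwards [hN.eventually_gt_atTop 0] with j hj
      have hj0 : ((m + δ j : ℕ) : ℝ) ^ K ≠ 0 := (pow_pos hj K).ne'
      have e := h (m + δ j)
      rw [Finset.sum_range_succ] at e
      have : (c K (m + δ j) + ∑ k ∈ Finset.range K,
          c k (m + δ j) * (((m + δ j : ℕ) : ℝ) ^ (K - k))⁻¹) * ((m + δ j : ℕ) : ℝ) ^ K = 0 := by
        rw [add_mul, Finset.sum_mul, ← e, add_comm]
        congr 1
        refine Finset.sum_congr rfl fun k hk => ?_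
        have hk' := Finset.mem_range.1 hk
        rw [mul_assoc]
        congr 1
        rw [← Nat.sub_add_cancel hk'.le, pow_add, Nat.add_sub_cancel, inv_mul_cancel_left₀]
        exact (pow_pos hj _).ne'
      exact ((mul_eq_zero.1 this).resolve_right hj0).symm
    have hrest := ih fun n => by simpa [Finset.sum_range_succ, htop] using h n
    intro k hk m
    rcases Nat.lt_succ_iff_lt_or_eq.1 hk with hk | rfl
    · exact hrest k hk m
    · exact htop m

/-- Orbits of linear isometries are recurrent. -/
theorem exists_tendsto_iterate (R : E3 →ₗᵢ[ℝ] E3) (y : E3) :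
    ∃ δ : ℕ → ℕ, Tendsto δ atTop atTop ∧ Tendsto (fun j => R^[δ j] y) atTop (𝓝 y) := by
  have hnorm : ∀ n, ∀ x, ‖R^[n] x‖ = ‖x‖ := by
    intro n
    induction n with
    | zero => simp
    | succ n ih => intro x; rw [Function.iterate_succ_apply, ih, R.norm_map]
  have hsub : ∀ n, ∀ x z, dist (R^[n] x) (R^[n] z) = dist x z := by
    intro n
    induction n with
    | zero => simp
    | succ n ih => intro x z; rw [Function.iterate_succ_apply, Function.iterate_succ_apply, ih,
        R.dist_map]
  obtain ⟨z, -, ψ, hψ, hz⟩ := (isCompact_closedBall (0 : E3) ‖y‖).tendsto_subseq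
    (x := fun n => R^[n] y) (fun n => by simp [hnorm])
  have hN : Tendsto (fun j => ψ j + j) atTop atTop :=
    tendsto_atTop_mono (fun j => Nat.le_add_left _ _) tendsto_id
  have hle : ∀ j, ψ j + j ≤ ψ (ψ j + j) := fun j => hψ.id_le _
  -- The iterates at both times approach `z`, and cancelling `ψ j` steps of the isometry compares
  -- the difference with `y`. The summand `j` in the index makes the gap at least `j`.
  refine ⟨fun j => ψ (ψ j + j) - ψ j, tendsto_atTop_mono (fun j => ?_) tendsto_id, ?_⟩
  · have := hle j
    simp only [id]; omega
  · rw [tendsto_iff_dist_tendsto_zero]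
    have h := (hz.comp hN).dist hz
    rw [dist_self] at h
    refine h.congr fun j => ?_
    have := hle j
    simp only [Function.comp]
    rw [← hsub (ψ j) _ y, ← Function.iterate_add_apply]
    congr 3
    omega

/-- The restriction of a polynomial to the parallels to a line, with coefficients depending
continuously on the starting point. -/
theorem exists_coeff_line (f : MvPolynomial (Fin 3) ℝ) (q b : E3) :
    ∃ (K : ℕ) (c : ℕ → E3 → ℝ), (∀ k, Continuous (c k)) ∧ ∀ (v : E3) (t : ℝ),
      MvPolynomial.eval (fun i => (q + v + t • b) i) f =
        ∑ k ∈ Finset.range K, c k v * t ^ k := by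
  induction f using MvPolynomial.induction_on with
  | C r => exact ⟨1, fun _ _ => r, fun _ => continuous_const, by simp⟩
  | add f g hf hg =>
    obtain ⟨K, c, hc, hf⟩ := hf
    obtain ⟨L, d, hd, hg⟩ := hg
    refine ⟨max K L, fun k v => (if k < K then c k v else 0) + (if k < L then d k v else 0),
      fun k => ?_, fun v t => ?_⟩
    · have := hc k; have := hd k
      dsimp only
      split_ifs <;> fun_prop
    · rw [map_add, hf, hg]
      simp only [add_mul, Finset.sum_add_distrib, ite_mul, zero_mul, ← Finset.sum_filter]
      congr 2 <;> ext k <;> simp <;> omega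
  | mul_X f i hf =>
    obtain ⟨K, c, hc, hf⟩ := hf
    -- The new factor is `(q i + v i) + t * b i`; its second term raises the degree in `t` by one.
    refine ⟨K + 1, fun k v => (if k < K then c k v * (q i + v i) else 0) +
      (if k = 0 then 0 else c (k - 1) v * b i), fun k => ?_, fun v t => ?_⟩
    · have := hc k; have := hc (k - 1)
      dsimp only
      split_ifs <;> fun_prop
    · rw [map_mul, hf, MvPolynomial.eval_X]
      simp only [add_mul, Finset.sum_add_distrib]
      rw [Finset.sum_range_succ, Finset.sum_range_succ' (fun k => (if k = 0 then 0 else _) * _)]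
      simp only [lt_irrefl, if_false, zero_mul, add_zero, Nat.add_sub_cancel, if_true,
        Nat.add_eq_zero_iff, one_ne_zero, and_false]
      rw [Finset.sum_mul, ← Finset.sum_add_distrib]
      refine Finset.sum_congr rfl fun k hk => ?_
      rw [if_pos (Finset.mem_range.1 hk)]
      simp only [PiLp.add_apply, PiLp.smul_apply, smul_eq_mul]
      ring

/-- An isometry that maps a non-cylindrical algebraic set into itself has a fixed point. -/
theorem exists_fixedPoint {S : Set E3} {F : Set (MvPolynomial (Fin 3) ℝ)}
    (hF : S = {p : E3 | ∀ f ∈ F, MvPolynomial.eval (fun i => p i) f = 0})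
    (hcyl : ¬ IsCylindrical S) (g : E3 ≃ᵃⁱ[ℝ] E3) (hg : ∀ x ∈ S, g x ∈ S) : ∃ x, g x = x := by
  set R : E3 →ₗᵢ[ℝ] E3 := g.linearIsometryEquiv.toLinearIsometry with hR
  have hgR : ∀ x y : E3, g (x + y) = g x + R y := by
    intro x y
    have := g.map_vadd x y
    simpa [add_comm, hR] using this
  -- split the displacement of the origin along the fixed space of `R` and its complement
  obtain ⟨q, b, hq, hb⟩ : ∃ q b : E3, g q = q + b ∧ R b = b := by
    set T : E3 →ₗ[ℝ] E3 := R.toLinearMap - LinearMap.id with hT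
    obtain ⟨y, hy, z, hz, hyz⟩ := T.range.exists_add_mem_mem_orthogonal (g 0)
    obtain ⟨w, rfl⟩ := hy
    have hRz : R z = z := by
      have h1 : ∀ v, ⟪R v - v, z⟫ = 0 := fun v => hz _ ⟨v, by simp [hT]⟩
      have h2 := h1 z
      rw [inner_sub_left, real_inner_self_eq_norm_sq] at h2
      have h3 : ‖R z - z‖ ^ 2 = 0 := by
        rw [norm_sub_sq_real, R.norm_map]; linarith
      exact sub_eq_zero.1 (norm_eq_zero.1 (pow_eq_zero_iff two_ne_zero |>.1 h3))
    refine ⟨-w, z, ?_, hRz⟩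
    have := hgR 0 (-w)
    rw [zero_add, hyz, R.map_neg] at this
    rw [this]
    simp only [hT, LinearMap.sub_apply, LinearMap.id_apply, LinearIsometry.coe_toLinearMap]
    abel
  by_cases hb0 : b = 0
  · exact ⟨q, by simpa [hb0] using hq⟩
  refine absurd ⟨b, hb0, fun x hx t => ?_⟩ hcyl
  have hiter : ∀ n : ℕ, q + R^[n] (x - q) + (n : ℝ) • b ∈ S := by
    intro n
    induction n with
    | zero => simpa using hx
    | succ n ih =>
      have := hg _ ih
      rw [add_assoc, hgR, hq, map_add, map_smul, hb, ← Function.iterate_succ_apply' R] at this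
      convert this using 1
      push_cast
      module
  obtain ⟨δ, hδ, hδR⟩ := exists_tendsto_iterate R (x - q)
  rw [hF]
  intro f hf
  obtain ⟨K, c, hc, hcf⟩ := exists_coeff_line f q b
  have hRc : ∀ m : ℕ, Continuous (R^[m]) := fun m => R.continuous.iterate m
  have hzero := eq_zero_of_sum_mul_pow_eq_zero hδ (c := fun k n => c k (R^[n] (x - q))) 
    (fun k m => by
      have := ((hc k).comp (hRc m)).tendsto (x - q) |>.comp hδR
      simpa [Function.comp_def, Function.iterate_add_apply] using this) K
    (fun n => by
      have := hiter n
      rw [hF] at this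
      rw [← hcf]
      exact this f hf)
  have := hcf (x - q) t
  rw [add_sub_cancel] at this
  rw [this]
  exact Finset.sum_eq_zero fun k hk => by
    -- The index `0` of the orbit is the starting point `x - q` itself.
    have := hzero k (Finset.mem_range.1 hk) 0
    simp only [Function.iterate_zero, id] at this
    rw [this, zero_mul]

/-! ### The common point of the symmetry planes -/

/-- The perpendicular bisector of `x` and its mirror image is `π` itself. -/
theorem mem_of_dist_eq_dist_reflection {π : AffineSubspace ℝ E3}
    (hπ : finrank ℝ π.direction = 2) [Nonempty π] {x z : E3}
    (h : dist z x = dist z (EuclideanGeometry.reflection π x)) (hx : x ∉ π) : z ∈ π := by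
  obtain ⟨⟨p, hp⟩⟩ := ‹Nonempty π›
  obtain ⟨n, hn, rfl⟩ := exists_normal hπ hp
  rw [reflection_mk' hn, planeRefl, dist_eq_norm, dist_eq_norm] at h
  rw [mem_mk'_orthogonal] at hx ⊢
  have e : z - (p + (x - p - (2 * ⟪n, x - p⟫) • n)) = (z - x) + (2 * ⟪n, x - p⟫) • n := by module
  have h2 : ‖z - x‖ ^ 2 = ‖z - x‖ ^ 2 + 2 * ((2 * ⟪n, x - p⟫) * ⟪n, z - x⟫) +
      (2 * ⟪n, x - p⟫) ^ 2 := by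
    conv_lhs => rw [h, e, norm_add_sq_real]
    rw [inner_smul_right, norm_smul, hn, mul_one, Real.norm_eq_abs, sq_abs,
      real_inner_comm n (z - x)]
  have e2 : z - p = (z - x) + (x - p) := by abel
  rw [e2, inner_add_right]
  have h3 : ⟪n, x - p⟫ * (⟪n, z - x⟫ + ⟪n, x - p⟫) = 0 := by linarith
  exact (mul_eq_zero.1 h3).resolve_left hx

/-- The symmetry planes of a non-cylindrical algebraic set have a common point. -/
theorem exists_mem_of_isSymmetryPlane {S : Set E3} {F : Set (MvPolynomial (Fin 3) ℝ)}
    (hF : S = {p : E3 | ∀ f ∈ F, MvPolynomial.eval (fun i => p i) f = 0})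
    (hcyl : ¬ IsCylindrical S) :
    ∃ p : E3, ∀ π : AffineSubspace ℝ E3, IsSymmetryPlane S π → p ∈ π := by
  -- take an isometry preserving `S` whose fixed space has the least dimension
  obtain ⟨g, hg, hmin⟩ := (measure fun g : E3 ≃ᵃⁱ[ℝ] E3 =>
    finrank ℝ (vectorSpan ℝ {x | g x = x})).wf.has_min {g | ∀ x ∈ S, g x ∈ S}
    ⟨AffineIsometryEquiv.refl ℝ E3, fun x hx => hx⟩
  obtain ⟨p, hp⟩ := exists_fixedPoint hF hcyl g hg
  refine ⟨p, fun π ⟨hπ, hne, hS⟩ => ?_⟩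
  by_contra hpπ
  set s := EuclideanGeometry.reflection π
  have hgs : ∀ x ∈ S, (s.trans g) x ∈ S := fun x hx => hg _ (hS ▸ Set.mem_image_of_mem s hx)
  have hfix : ∀ x, g (s x) = x → x ∈ π ∧ g x = x := by
    intro x hx
    by_cases hxπ : x ∈ π
    · rw [(EuclideanGeometry.reflection_eq_self_iff x).2 hxπ] at hx
      exact ⟨hxπ, hx⟩
    · refine absurd (mem_of_dist_eq_dist_reflection hπ ?_ hxπ) hpπ
      conv_lhs => rw [← hp, ← hx, g.dist_map]
  obtain ⟨y, hy⟩ := exists_fixedPoint hF hcyl _ hgs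
  have hyfix := hfix y hy
  refine hmin _ hgs (?_ : finrank ℝ (vectorSpan ℝ {x | g (s x) = x}) < _)
  -- If the two spans agreed, `p - y` would be a direction of `π`, and `y ∈ π` would force `p ∈ π`.
  refine Submodule.finrank_lt_finrank_of_lt (lt_of_le_of_ne
    (vectorSpan_mono ℝ fun x hx => (hfix x hx).2) fun h => hpπ ?_)
  have h1 : p -ᵥ y ∈ vectorSpan ℝ {x | g (s x) = x} :=
    h ▸ vsub_mem_vectorSpan ℝ (show p ∈ {x | g x = x} from hp) hyfix.2
  have h2 : p -ᵥ y ∈ π.direction := vectorSpan_mono ℝ (fun x hx => (hfix x hx).1) h1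
  exact (AffineSubspace.vsub_right_mem_direction_iff_mem hyfix.1 p).1 h2

/-! ### From infinitely many planes to rotations -/

theorem isClosed_of_zeros {S : Set E3} {F : Set (MvPolynomial (Fin 3) ℝ)}
    (hF : S = {p : E3 | ∀ f ∈ F, MvPolynomial.eval (fun i => p i) f = 0}) : IsClosed S := by
  rw [hF]
  simp only [Set.ofPred_forall]
  refine isClosed_biInter fun f _ => isClosed_eq ?_ continuous_const
  exact (MvPolynomial.continuous_eval f).comp (by fun_prop)

/-- A closed set preserved by arbitrarily small rotations in planes converging to a given plane
is preserved by all rotations in the limit plane. -/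
theorem planeRot_mem_of_tendsto {T : Set E3} (hT : IsClosed T) {a b : ℕ → E3} {φ : ℕ → ℝ}
    (ha : ∀ k, ‖a k‖ = 1) (hb : ∀ k, ‖b k‖ = 1) (hab : ∀ k, ⟪a k, b k⟫ = 0)
    (hφ : ∀ k, 0 < φ k) (hφ0 : Tendsto φ atTop (𝓝 0)) {a' b' : E3}
    (ha' : Tendsto a atTop (𝓝 a')) (hb' : Tendsto b atTop (𝓝 b'))
    (h : ∀ k, ∀ x ∈ T, planeRot (a k) (b k) (φ k) x ∈ T) (t : ℝ) :
    ∀ x ∈ T, planeRot a' b' t x ∈ T := by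
  have hmul : ∀ k (m : ℕ), ∀ x ∈ T, planeRot (a k) (b k) (m * φ k) x ∈ T := by
    intro k m
    induction m with
    | zero => intro x hx; simpa [planeRot_zero] using hx
    | succ m ih =>
      intro x hx
      rw [Nat.cast_succ, add_mul, one_mul, planeRot_add (ha k) (hb k) (hab k)]
      exact ih _ (h k x hx)
  have hnonneg : ∀ t : ℝ, 0 ≤ t → ∀ x ∈ T, planeRot a' b' t x ∈ T := by
    intro t ht x hx
    -- Rounding `t` down to a multiple of `φ k` costs at most `φ k`.
    have hlim : Tendsto (fun k => (⌊t / φ k⌋₊ : ℝ) * φ k) atTop (𝓝 t) := by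
      have hlow : Tendsto (fun k => t - φ k) atTop (𝓝 t) := by
        simpa using tendsto_const_nhds.sub hφ0
      refine tendsto_of_tendsto_of_tendsto_of_le_of_le hlow tendsto_const_nhds
        (fun k => ?_) fun k => ?_
      · have := (div_lt_iff₀ (hφ k)).1 (Nat.lt_floor_add_one (t / φ k))
        dsimp only
        linarith
      · exact (le_div_iff₀ (hφ k)).1 (Nat.floor_le (div_nonneg ht (hφ k).le))
    refine hT.mem_of_tendsto (b := atTop) (f := fun k => planeRot (a k) (b k) (⌊t / φ k⌋₊ * φ k) x) ?_
      (Eventually.of_forall fun k => hmul k _ x hx)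
    have hx' : Tendsto (fun _ : ℕ => x) atTop (𝓝 x) := tendsto_const_nhds
    have hax := ha'.inner (𝕜 := ℝ) hx'
    have hbx := hb'.inner (𝕜 := ℝ) hx'
    have hcos := (Real.continuous_cos.tendsto t).comp hlim
    have hsin := (Real.continuous_sin.tendsto t).comp hlim
    exact (hx'.add ((hcos.sub tendsto_const_nhds).smul ((hax.smul ha').add (hbx.smul hb')))).add
      (hsin.smul ((hax.smul hb').sub (hbx.smul ha')))
  -- Full turns make a negative angle nonnegative.
  obtain ⟨N, hN⟩ := exists_nat_ge (-t / (2 * Real.pi))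
  rw [div_le_iff₀ Real.two_pi_pos] at hN
  rw [← planeRot_add_nat_mul_two_pi a' b' t N]
  exact hnonneg _ (by linarith)

/-- Gram–Schmidt: `m` is the normalized part of `w` orthogonal to `v`, whose length is the sine of
the angle. It is nonzero since `w ≠ ±v`. -/
theorem exists_eq_cos_smul_add_sin_smul {v w : E3} (hv : ‖v‖ = 1) (hw : ‖w‖ = 1)
    (hvw : (ℝ ∙ v) ≠ ℝ ∙ w) :
    ∃ m : E3, ‖m‖ = 1 ∧ ⟪v, m⟫ = 0 ∧ 0 < Real.arccos ⟪v, w⟫ ∧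
      w = Real.cos (Real.arccos ⟪v, w⟫) • v + Real.sin (Real.arccos ⟪v, w⟫) • m := by
  set c := ⟪v, w⟫ with hc
  have hvv : ⟪v, v⟫ = 1 := by rw [real_inner_self_eq_norm_sq, hv]; norm_num
  have hd0 : w - c • v ≠ 0 := by
    intro h
    rw [sub_eq_zero] at h
    have hc0 : c ≠ 0 := by rintro h0; rw [h0, zero_smul] at h; simp [h] at hw
    exact hvw (h ▸ (Submodule.span_singleton_smul_eq (IsUnit.mk0 _ hc0) v).symm)
  have hdpos := norm_pos_iff.2 hd0
  have hd : ‖w - c • v‖ ^ 2 = 1 - c ^ 2 := by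
    rw [norm_sub_sq_real, inner_smul_right, norm_smul, hv, hw, real_inner_comm, ← hc,
      Real.norm_eq_abs, mul_one, sq_abs]
    ring
  have hc1 : |c| ≤ 1 := by simpa [hv, hw] using abs_real_inner_le_norm v w
  have hsin : Real.sin (Real.arccos c) = ‖w - c • v‖ := by
    rw [Real.sin_arccos, ← hd, Real.sqrt_sq hdpos.le]
  refine ⟨‖w - c • v‖⁻¹ • (w - c • v), norm_smul_inv_norm hd0, ?_, ?_, ?_⟩
  · rw [inner_smul_right, inner_sub_right, inner_smul_right, hvv, ← hc]
    ring
  · refine (Real.arccos_nonneg c).lt_of_ne fun h => ?_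
    rw [← h, Real.sin_zero] at hsin
    exact hdpos.ne hsin
  · rw [hsin, Real.cos_arccos (abs_le.1 hc1).1 (abs_le.1 hc1).2, smul_inv_smul₀ hdpos.ne']
    abel

/-- A closed set with infinitely many symmetry planes through one point is a surface of
revolution. -/
theorem isSurfaceOfRevolution_of_infinite {S : Set E3} (hS : IsClosed S) {p : E3}
    (hp : ∀ π : AffineSubspace ℝ E3, IsSymmetryPlane S π → p ∈ π)
    (hinf : {π : AffineSubspace ℝ E3 | IsSymmetryPlane S π}.Infinite) :
    IsSurfaceOfRevolution S := by
  set P := hinf.natEmbedding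
  have hPS : ∀ k, IsSymmetryPlane S (P k : AffineSubspace ℝ E3) := fun k => (P k).2
  choose n hn hPn using fun k => exists_normal (hPS k).1 (hp _ (hPS k))
  have hspan : ∀ k l, k ≠ l → (ℝ ∙ n k) ≠ ℝ ∙ n l := by
    intro k l hkl h
    exact hkl (P.injective (Subtype.ext (by rw [hPn k, hPn l, h])))
  obtain ⟨a', -, ψ, hψ, ha'⟩ := (isCompact_sphere (0 : E3) 1).tendsto_subseq
    (x := n) (fun k => by simp [hn])
  -- Consecutive normals of the convergent subsequence enclose positive angles tending to zero; a
  -- further subsequence makes the rotation planes converge too.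
  choose m hm hnm hpos hdec using fun k => exists_eq_cos_smul_add_sin_smul (hn (ψ k))
    (hn (ψ (k + 1))) (hspan _ _ (hψ.injective.ne (Nat.succ_ne_self k).symm))
  obtain ⟨b', -, χ, hχ, hb'⟩ := (isCompact_sphere (0 : E3) 1).tendsto_subseq
    (x := m) (fun k => by simp [hm])
  have ha'n : ‖a'‖ = 1 :=
    tendsto_nhds_unique ha'.norm (by simp [hn])
  have hb'n : ‖b'‖ = 1 :=
    tendsto_nhds_unique hb'.norm (by simp [hm])
  have hχa : Tendsto (fun k => n (ψ (χ k))) atTop (𝓝 a') := ha'.comp hχ.tendsto_atTop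
  have hab' : ⟪a', b'⟫ = 0 :=
    tendsto_nhds_unique (hχa.inner (𝕜 := ℝ) hb') (by simp [hnm])
  have hangle : Tendsto (fun k => 2 * Real.arccos ⟪n (ψ k), n (ψ (k + 1))⟫) atTop (𝓝 0) := by
    have h1 := ha'.inner (𝕜 := ℝ) (ha'.comp (tendsto_add_atTop_nat 1))
    rw [real_inner_self_eq_norm_sq, ha'n, one_pow] at h1
    simpa using ((Real.continuous_arccos.tendsto 1).comp h1).const_mul 2
  have hT : IsClosed {x : E3 | p + x ∈ S} := hS.preimage (by fun_prop)
  have hrefl : ∀ k, ∀ x ∈ {x : E3 | p + x ∈ S}, planeRefl (n k) x ∈ {x : E3 | p + x ∈ S} :=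
    fun k => (isSymmetryPlane_mk'_iff (hn k) p).1 (hPn k ▸ hPS k)
  have hrot := planeRot_mem_of_tendsto hT (fun k => hn (ψ (χ k))) (fun k => hm (χ k))
    (fun k => hnm (χ k)) (fun k => mul_pos two_pos (hpos (χ k)))
    (hangle.comp hχ.tendsto_atTop) hχa hb' fun k x hx => by
      rw [← planeRefl_planeRefl (hn _) (hnm _), ← hdec]
      exact hrefl _ _ (hrefl _ _ hx)
  refine ⟨p, cross a' b', norm_cross_of_orthonormal ha'n hb'n hab', fun θ => ?_⟩
  have key : ∀ θ, ∀ x ∈ S, axisRotation p (cross a' b') θ x ∈ S := by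
    intro θ x hx
    rw [axisRotation_cross ha'n hb'n hab']
    exact hrot θ _ (by simpa using hx)
  refine Set.Subset.antisymm (Set.image_subset_iff.2 (key θ)) fun x hx => ⟨_, key (-θ) x hx, ?_⟩
  rw [axisRotation_cross ha'n hb'n hab', axisRotation_cross ha'n hb'n hab', add_sub_cancel_left,
    ← planeRot_add ha'n hb'n hab', add_neg_cancel, planeRot_zero, add_sub_cancel]

/-! ### From rotations to infinitely many planes -/

/-- A reflection in a plane through the axis moves every point in the same way as some rotation
about the axis. -/
theorem exists_planeRot_eq_planeRefl (a b x : E3) : ∃ t : ℝ, planeRot a b t x = planeRefl a x := by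
  set z : ℂ := ⟨⟪a, x⟫, ⟪b, x⟫⟩
  have hre : ‖z‖ * Real.cos z.arg = ⟪a, x⟫ := by rw [Complex.norm_mul_cos_arg]
  have him : ‖z‖ * Real.sin z.arg = ⟪b, x⟫ := by rw [Complex.norm_mul_sin_arg]
  -- Negating the `a`-coordinate sends the polar angle `z.arg` to `π - z.arg`.
  refine ⟨Real.pi - 2 * z.arg, ?_⟩
  have h := Real.sin_sq_add_cos_sq z.arg
  rw [planeRot, planeRefl, Real.cos_pi_sub, Real.sin_pi_sub, Real.cos_two_mul, Real.sin_two_mul,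
    ← hre, ← him]
  match_scalars
  · ring
  · linear_combination (-2 * ‖z‖ * Real.cos z.arg) * h
  · ring

theorem infinite_of_isSurfaceOfRevolution {S : Set E3} (hS : IsSurfaceOfRevolution S) :
    {π : AffineSubspace ℝ E3 | IsSymmetryPlane S π}.Infinite := by
  obtain ⟨q, u, hu, hrot⟩ := hS
  have hplane : ∀ a : E3, ‖a‖ = 1 → ⟪u, a⟫ = 0 →
      IsSymmetryPlane S (AffineSubspace.mk' q (ℝ ∙ a)ᗮ) := by
    intro a ha hua
    have hb : ‖cross u a‖ = 1 := norm_cross_of_orthonormal hu ha hua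
    have haa : ⟪a, a⟫ = 1 := by rw [real_inner_self_eq_norm_sq, ha]; norm_num
    have hcross : cross a (cross u a) = u := by
      rw [cross_cross_left, haa, real_inner_comm, hua]; simp
    rw [isSymmetryPlane_mk'_iff ha]
    intro x hx
    obtain ⟨t, ht⟩ := exists_planeRot_eq_planeRefl a (cross u a) x
    have h := axisRotation_cross ha hb (inner_cross_self_right u a) q t (q + x)
    rw [add_sub_cancel_left, hcross, ht] at h
    rw [← h, ← hrot t]
    exact Set.mem_image_of_mem _ hx
  obtain ⟨a, ha, hua⟩ : ∃ a : E3, ‖a‖ = 1 ∧ ⟪u, a⟫ = 0 := by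
    have h4 := (ℝ ∙ u).finrank_add_finrank_orthogonal
    have h3 : finrank ℝ E3 = 3 := by simp
    rw [finrank_span_singleton (by rintro rfl; simp at hu)] at h4
    obtain ⟨⟨v, hv⟩, hv0⟩ := (finrank_pos_iff_exists_ne_zero (R := ℝ) (M := (ℝ ∙ u)ᗮ)).1 (by omega)
    have hv0' : v ≠ 0 := fun h => hv0 (by simpa using h)
    refine ⟨‖v‖⁻¹ • v, norm_smul_inv_norm hv0', ?_⟩
    rw [inner_smul_right, Submodule.mem_orthogonal_singleton_iff_inner_right.1 hv, mul_zero]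
  have haa : ⟪a, a⟫ = 1 := by rw [real_inner_self_eq_norm_sq, ha]; norm_num
  set b := cross u a with hb
  have hub : ⟪u, b⟫ = 0 := inner_cross_self_left u a
  have hab : ⟪a, b⟫ = 0 := inner_cross_self_right u a
  have hbb : ⟪b, b⟫ = 1 := by
    rw [real_inner_self_eq_norm_sq, norm_cross_of_orthonormal hu ha hua]; norm_num
  have hba : ⟪b, a⟫ = 0 := by rw [real_inner_comm]; exact hab
  refine Set.infinite_of_injective_forall_mem
    (f := fun t : ℝ => AffineSubspace.mk' q (ℝ ∙ (a + t • b))ᗮ) (fun s t hst => ?_) fun t => ?_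
  -- This point lies on the plane with parameter `s`; on the one with parameter `t` it would need `t
  -- - s = 0`.
  · have h1 : q + (b - s • a) ∈ AffineSubspace.mk' q (ℝ ∙ (a + s • b))ᗮ := by
      rw [mem_mk'_orthogonal, add_sub_cancel_left]
      simp only [inner_sub_right, inner_add_left, inner_smul_left, inner_smul_right, haa, hbb, hab,
        hba, RCLike.conj_to_real]
      ring
    rw [show AffineSubspace.mk' q (ℝ ∙ (a + s • b))ᗮ = AffineSubspace.mk' q (ℝ ∙ (a + t • b))ᗮ
      from hst, mem_mk'_orthogonal, add_sub_cancel_left] at h1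
    simp only [inner_sub_right, inner_add_left, inner_smul_left, inner_smul_right, haa, hbb, hab,
        hba, RCLike.conj_to_real] at h1
    linarith
  · have hne : a + t • b ≠ 0 := by
      intro h
      have : ⟪a, a + t • b⟫ = 0 := by rw [h, inner_zero_right]
      rw [inner_add_right, inner_smul_right, haa, hab] at this
      norm_num at this
    have hn0 := inv_ne_zero (norm_ne_zero_iff.2 hne)
    have hunit := hplane (‖a + t • b‖⁻¹ • (a + t • b)) (norm_smul_inv_norm hne) (by
      rw [inner_smul_right, inner_add_right, inner_smul_right, hua, hub]; ring)
    rwa [Submodule.span_singleton_smul_eq (IsUnit.mk0 _ hn0)] at hunit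

end SymmetryPlanes

theorem mainTheorem6 (S : Set SymmetryPlanes.E3)
    (hS : SymmetryPlanes.IsAlgebraicSurface S)
    (hcyl : ¬ SymmetryPlanes.IsCylindrical S) :
    (¬ SymmetryPlanes.IsSurfaceOfRevolution S →
      {π : AffineSubspace ℝ SymmetryPlanes.E3 | SymmetryPlanes.IsSymmetryPlane S π}.Finite ∧
        ∃ p : SymmetryPlanes.E3, ∀ π : AffineSubspace ℝ SymmetryPlanes.E3,
          SymmetryPlanes.IsSymmetryPlane S π → p ∈ π) ∧
    (SymmetryPlanes.IsSurfaceOfRevolution S ↔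
      {π : AffineSubspace ℝ SymmetryPlanes.E3 | SymmetryPlanes.IsSymmetryPlane S π}.Infinite) := by
  obtain ⟨⟨F, hF⟩, -⟩ := hS
  obtain ⟨p, hp⟩ := SymmetryPlanes.exists_mem_of_isSymmetryPlane hF hcyl
  have hrev := SymmetryPlanes.isSurfaceOfRevolution_of_infinite
    (SymmetryPlanes.isClosed_of_zeros hF) hp
  exact ⟨fun h => ⟨Set.not_infinite.1 fun hinf => h (hrev hinf), p, hp⟩,
    SymmetryPlanes.infinite_of_isSurfaceOfRevolution, hrev⟩
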